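/- Conventions. A Lie groupoid $R\rightrightarrows M$ has source and target maps $s,t$; the product $xy$ is defined when $t(x)=s(y)$, and $r\cdot l$ is defined when $t(r)=p(l)$ for a left action on $p:L\to M$. A circle bundle over $R\rightrightarrows M$ is a principal $S^1$-bundle $p:L\to M$ with a smooth left action of $R$ that commutes with the $S^1$-action. An $S^1$-central extension $R\xrightarrow{\pi}\Gamma\rightrightarrows M$ of a Lie groupoid $\Gamma\rightrightarrows M$ is a Lie groupoid $R\rightrightarrows M$ with a morphism $\pi$ of Lie groupoids over $\mathrm{id}_M$ that is a principal $S^1$-bundle $R\to\Gamma$ and satisfies $(\lambda x)(\mu y)=\lambda\mu\,(xy)$. For $m\in M$ put $f_m(\lambda)=\lambda\cdot 1_m\in R$, $\lambda\in S^1$, and let $\epsilon:M\to\Gamma$ be the unit map. The index $\mathrm{Ind}_m(L)\in\mathbb Z$ is the integer $k$ for which the circle bundle $f_m^*L$ over the groupoid $S^1\rightrightarrows\cdot$ is isomorphic to $B_k$, the bundle $S^1\to\cdot$ on which $\lambda$ acts by $z\mapsto\lambda^kz$. In the total de Rham complex of a Lie groupoid put $\partial\beta=s^*\beta-t^*\beta$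 for a form $\beta$ on the objects, $\partial g=\mathrm{pr}_1^*g-\mu^*g+\mathrm{pr}_2^*g$ for a function $g$ on the arrows ($\mu$ the product), and $\delta=\partial+(-1)^q d$ on forms on composable $q$-tuples. A connection form on a principal $S^1$-bundle is an invariant real $1$-form that is $1$ on the generator $\frac{d}{dt}\big|_{t=0}\,x\cdot e^{2\pi i t}$. The Chern class of $L$ is the class $[\theta'+\omega']$ with $\theta'\in\Omega^1(R)$, $\omega'\in\Omega^2(M)$ such that $\delta\alpha$ is the pull-back of $\theta'+\omega'$ to the transformation groupoid $R\times_ML\rightrightarrows L$ (in which $(r,l)$ has source $r\cdot l$ and target $l$) for a connection form $\alpha\in\Omega^1(L)$ on $L\to M$. The form $\theta+\omega$ represents it if $(\theta+\omega)-(\theta'+\omega')=\delta(g+\beta)$ for some $g\in C^\infty(R)$, $\beta\in\Omega^1(M)$. Statement. Let $R\xrightarrow{\pi}\Gamma\rightrightarrows M$ be an $S^1$-central extension such that the orbit space $M/\Gamma$ is path-connected, and let $L\to M$ be a circle bundle over $R\rightrightarrows M$ whose Chern class is represented by $\theta+\omega\in\Omega^1(R)\oplus\Omega^2(M)$. Then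 the index $\mathrm{Ind}_m(L)$ is well defined for each $m\in M$ and satisfies $$f_m(\lambda)\cdot l=l\cdot\lambda^{\mathrm{Ind}_m(L)}\qquad(\lambda\in S^1,\ l\in p^{-1}(m)),$$ it does not depend on $m$, and for every $m\in M$ $$\mathrm{Ind}(L)=\int_{\pi^{-1}(\epsilon(m))}\theta ,$$ where the circle $\pi^{-1}(\epsilon(m))=f_m(S^1)$ is oriented by the $S^1$-action. Consequently, for every $m\in M$, the complex line bundle $L\times_{S^1}\mathbb C$ associated with $L$ is a $(\Gamma,R)$-twisted line bundle, i.e. $\ker\pi\cong M\times S^1$ acts on it by scalar multiplication, if and only if $\int_{\pi^{-1}(\epsilon(m))}\theta=1$. -/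

import Mathlib

open scoped Manifold ContDiff Topology

noncomputable section

namespace CircleExtension

/-! ## Differential forms on manifolds -/

section Forms

variable {E F : Type*} [NormedAddCommGroup E] [NormedSpace ℝ E]
  [NormedAddCommGroup F] [NormedSpace ℝ F]
  {N P : Type*} [TopologicalSpace N] [ChartedSpace E N]
  [TopologicalSpace P] [ChartedSpace F P]

variable (E) in
/-- A field of alternating `k`-linear forms on the tangent spaces of `N` (no regularity). -/
abbrev RawForm (N : Type*) [TopologicalSpace N] [ChartedSpace E N] (k : ℕ) : Type _ :=
  ∀ x : N, TangentSpace 𝓘(ℝ, E) x [⋀^Fin k]→L[ℝ] ℝ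

/-- The expression of a form in the preferred chart at `x₀`: its pull-back by the inverse chart. -/
def formInChart {k : ℕ} (η : RawForm E N k) (x₀ : N) : E → E [⋀^Fin k]→L[ℝ] ℝ :=
  fun y => (η ((extChartAt 𝓘(ℝ, E) x₀).symm y)).compContinuousLinearMap
    (mfderiv 𝓘(ℝ, E) 𝓘(ℝ, E) (extChartAt 𝓘(ℝ, E) x₀).symm y)

variable (E) in
/-- Smooth differential `k`-forms on `N`, i.e. elements of `Ω^k(N)`. -/
structure DiffForm (N : Type*) [TopologicalSpace N] [ChartedSpace E N] (k : ℕ) where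
  toFun : RawForm E N k
  smooth : ∀ x₀ : N, ContDiffOn ℝ ∞ (formInChart toFun x₀) (extChartAt 𝓘(ℝ, E) x₀).target

/-- The exterior derivative, computed at `x` in the preferred chart at `x`. -/
def extD {k : ℕ} (η : DiffForm E N k) : RawForm E N (k + 1) := fun x =>
  (extDeriv (formInChart η.toFun x) (extChartAt 𝓘(ℝ, E) x x)).compContinuousLinearMap
    (mfderiv 𝓘(ℝ, E) 𝓘(ℝ, E) (extChartAt 𝓘(ℝ, E) x) x)

/-- The pull-back `f^* η`. -/
def pullback {k : ℕ} (f : N → P) (η : DiffForm F P k) : RawForm E N k := fun x =>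
  (η.toFun (f x)).compContinuousLinearMap (mfderiv 𝓘(ℝ, E) 𝓘(ℝ, F) f x)

/-- The value of a `1`-form on a tangent vector. -/
def DiffForm.eval (θ : DiffForm E N 1) (x : N) (u : TangentSpace 𝓘(ℝ, E) x) : ℝ :=
  θ.toFun x (fun _ => u)

variable (E) in
/-- The velocity vector of a curve. -/
def velocity (c : ℝ → N) (t : ℝ) : TangentSpace 𝓘(ℝ, E) (c t) :=
  mfderiv 𝓘(ℝ, ℝ) 𝓘(ℝ, E) c t (1 : ℝ)

/-- The parametrization `t ↦ e^{2πit} • x`, `0 ≤ t ≤ 1`, of the circle orbit of `x`. -/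
def orbitCurve [MulAction Circle N] (x : N) (t : ℝ) : N := Circle.exp (2 * Real.pi * t) • x

/-- The integral `∫_{S¹} f^* θ` of a `1`-form along the orbit map `f : S¹ → N`, `λ ↦ λ • x`. For a
free action this is the integral of `θ` over the orbit of `x` oriented by the circle action. -/
def orbitIntegral [MulAction Circle N] (θ : DiffForm E N 1) (x : N) : ℝ :=
  ∫ t in (0 : ℝ)..1, θ.eval (orbitCurve x t) (velocity E (orbitCurve x) t)

end Forms

/-! ## Principal circle bundles

As the circle is commutative, left and right actions are the same thing: for a right principal
bundle, `z • x` stands for `x · z`. -/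

section Bundles

variable (E F : Type*) [NormedAddCommGroup E] [NormedSpace ℝ E]
  [NormedAddCommGroup F] [NormedSpace ℝ F]
  {P B : Type*} [TopologicalSpace P] [ChartedSpace E P]
  [TopologicalSpace B] [ChartedSpace F B] [MulAction Circle P]

/-- `p : P → B` is a smooth principal circle bundle: it is locally, by equivariant
diffeomorphisms, the product bundle `U × S¹ → U`. -/
structure IsPrincipalCircleBundle (p : P → B) : Prop where
  contMDiff_smul : ContMDiff ((𝓡 1).prod 𝓘(ℝ, E)) 𝓘(ℝ, E) ∞ (fun q : Circle × P => q.1 • q.2)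
  contMDiff_proj : ContMDiff 𝓘(ℝ, E) 𝓘(ℝ, F) ∞ p
  proj_smul : ∀ (z : Circle) (x : P), p (z • x) = p x
  locally_trivial : ∀ b : B, ∃ (U : Set B) (e : OpenPartialHomeomorph P (B × Circle)),
    IsOpen U ∧ b ∈ U ∧ e.source = p ⁻¹' U ∧ e.target = U ×ˢ Set.univ ∧
    ContMDiffOn 𝓘(ℝ, E) (𝓘(ℝ, F).prod (𝓡 1)) ∞ e e.source ∧
    ContMDiffOn (𝓘(ℝ, F).prod (𝓡 1)) 𝓘(ℝ, E) ∞ e.symm e.target ∧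
    (∀ x ∈ e.source, (e x).1 = p x) ∧
    (∀ x ∈ e.source, ∀ z : Circle, e (z • x) = ((e x).1, z * (e x).2))

variable {E F} in
/-- `α` is a connection `1`-form on the principal circle bundle `P`: it is invariant, and it takes
the value `1` on the generator `d/dt (e^{2πit} • x)` of the action, so that its integral over each
fibre is `1`. -/
structure IsConnectionForm (α : DiffForm E P 1) : Prop where
  invariant : ∀ z : Circle, pullback (fun x : P => z • x) α = α.toFun
  normalized : ∀ x : P, α.eval (orbitCurve x 0) (velocity E (orbitCurve x) 0) = 1

end Bundles

/-! ## Lie groupoids -/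

section Groupoids

variable (EM EG : Type*) [NormedAddCommGroup EM] [NormedSpace ℝ EM]
  [NormedAddCommGroup EG] [NormedSpace ℝ EG]
  (M G : Type*) [TopologicalSpace M] [ChartedSpace EM M]
  [TopologicalSpace G] [ChartedSpace EG G]

/-- A Lie groupoid `G ⇉ M`. The product `x y` is meant when `tgt x = src y`; the total function
`mul` carries no condition on other pairs. The fibre product of composable pairs is an embedded
submanifold of `G × G`, as `src` and `tgt` are submersions, and a map on an embedded submanifold is
smooth if and only if it is `ContMDiffOn` as a map on that subset of the ambient manifold. -/
structure LieGroupoid where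
  src : G → M
  tgt : G → M
  unit : M → G
  inv : G → G
  mul : G → G → G
  contMDiff_src : ContMDiff 𝓘(ℝ, EG) 𝓘(ℝ, EM) ∞ src
  contMDiff_tgt : ContMDiff 𝓘(ℝ, EG) 𝓘(ℝ, EM) ∞ tgt
  submersion_src : ∀ x, Function.Surjective (mfderiv 𝓘(ℝ, EG) 𝓘(ℝ, EM) src x)
  submersion_tgt : ∀ x, Function.Surjective (mfderiv 𝓘(ℝ, EG) 𝓘(ℝ, EM) tgt x)
  contMDiff_unit : ContMDiff 𝓘(ℝ, EM) 𝓘(ℝ, EG) ∞ unit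
  contMDiff_inv : ContMDiff 𝓘(ℝ, EG) 𝓘(ℝ, EG) ∞ inv
  contMDiff_mul : ContMDiffOn (𝓘(ℝ, EG).prod 𝓘(ℝ, EG)) 𝓘(ℝ, EG) ∞
    (fun q : G × G => mul q.1 q.2) {q : G × G | tgt q.1 = src q.2}
  src_unit : ∀ m, src (unit m) = m
  tgt_unit : ∀ m, tgt (unit m) = m
  src_mul : ∀ x y, tgt x = src y → src (mul x y) = src x
  tgt_mul : ∀ x y, tgt x = src y → tgt (mul x y) = tgt y
  mul_assoc : ∀ x y z, tgt x = src y → tgt y = src z → mul (mul x y) z = mul x (mul y z)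
  unit_mul : ∀ x, mul (unit (src x)) x = x
  mul_unit : ∀ x, mul x (unit (tgt x)) = x
  src_inv : ∀ x, src (inv x) = tgt x
  tgt_inv : ∀ x, tgt (inv x) = src x
  mul_inv : ∀ x, mul x (inv x) = unit (src x)
  inv_mul : ∀ x, mul (inv x) x = unit (tgt x)

variable {EM EG M G}

/-- Two points of `M` lie in the same orbit if they are joined by an arrow. -/
def LieGroupoid.orbitSetoid (𝒢 : LieGroupoid EM EG M G) : Setoid M where
  r m n := ∃ x : G, 𝒢.src x = m ∧ 𝒢.tgt x = n
  iseqv :=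
    { refl := fun m => ⟨𝒢.unit m, 𝒢.src_unit m, 𝒢.tgt_unit m⟩
      symm := by
        rintro m n ⟨x, rfl, rfl⟩
        exact ⟨𝒢.inv x, 𝒢.src_inv x, 𝒢.tgt_inv x⟩
      trans := by
        rintro m n k ⟨x, rfl, hx⟩ ⟨y, hy, rfl⟩
        exact ⟨𝒢.mul x y, 𝒢.src_mul x y (hx.trans hy.symm), 𝒢.tgt_mul x y (hx.trans hy.symm)⟩ }

/-- The space of orbits, with the quotient topology. -/
abbrev LieGroupoid.OrbitSpace (𝒢 : LieGroupoid EM EG M G) : Type _ := Quotient 𝒢.orbitSetoid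

end Groupoids

/-! ## Central extensions and circle bundles over them -/

section Extensions

variable {EM EG ER EL : Type*} [NormedAddCommGroup EM] [NormedSpace ℝ EM]
  [NormedAddCommGroup EG] [NormedSpace ℝ EG] [NormedAddCommGroup ER] [NormedSpace ℝ ER]
  [NormedAddCommGroup EL] [NormedSpace ℝ EL]
  {M G R L : Type*} [TopologicalSpace M] [ChartedSpace EM M]
  [TopologicalSpace G] [ChartedSpace EG G] [TopologicalSpace R] [ChartedSpace ER R]
  [TopologicalSpace L] [ChartedSpace EL L] [MulAction Circle L]

/-- `π : R → G` makes `R ⇉ M` a circle central extension of `G ⇉ M`. -/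
structure IsCentralExtension [MulAction Circle R] (ℛ : LieGroupoid EM ER M R) (𝒢 : LieGroupoid EM EG M G)
    (π : R → G) : Prop where
  principal : IsPrincipalCircleBundle ER EG π
  src_map : ∀ x, 𝒢.src (π x) = ℛ.src x
  tgt_map : ∀ x, 𝒢.tgt (π x) = ℛ.tgt x
  map_unit : ∀ m, π (ℛ.unit m) = 𝒢.unit m
  map_mul : ∀ x y, ℛ.tgt x = ℛ.src y → π (ℛ.mul x y) = 𝒢.mul (π x) (π y)
  smul_mul_smul : ∀ (z w : Circle) (x y : R), ℛ.tgt x = ℛ.src y →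
    ℛ.mul (z • x) (w • y) = (z * w) • ℛ.mul x y

/-- The homomorphism `f_m : S¹ → R`, `λ ↦ λ • 1_m`. -/
def LieGroupoid.centralMap [MulAction Circle R] (ℛ : LieGroupoid EM ER M R) (m : M)
    (z : Circle) : R := z • ℛ.unit m

variable (EL L) in
/-- A circle bundle `L → M` over the Lie groupoid `R ⇉ M`. The element `act r l` is meant when
`tgt r = proj l`; the total function `act` carries no condition on other pairs. -/
structure GroupoidCircleBundle (ℛ : LieGroupoid EM ER M R) where
  proj : L → M
  act : R → L → L
  principal : IsPrincipalCircleBundle EL EM proj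
  contMDiff_act : ContMDiffOn (𝓘(ℝ, ER).prod 𝓘(ℝ, EL)) 𝓘(ℝ, EL) ∞
    (fun q : R × L => act q.1 q.2) {q : R × L | ℛ.tgt q.1 = proj q.2}
  proj_act : ∀ r l, ℛ.tgt r = proj l → proj (act r l) = ℛ.src r
  unit_act : ∀ l, act (ℛ.unit (proj l)) l = l
  mul_act : ∀ x y l, ℛ.tgt x = ℛ.src y → ℛ.tgt y = proj l →
    act (ℛ.mul x y) l = act x (act y l)
  act_smul : ∀ r l (z : Circle), ℛ.tgt r = proj l → act r (z • l) = z • act r l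

namespace GroupoidCircleBundle

variable {ℛ : LieGroupoid EM ER M R} (𝓛 : GroupoidCircleBundle EL L ℛ)

/-- The manifold `Q = R ×_M L` of arrows of the transformation groupoid `Q ⇉ L`; the arrow `(r, l)`
has source `r · l` and target `l`. -/
def actionArrows : Set (R × L) := {q | ℛ.tgt q.1 = 𝓛.proj q.2}

/-- The `1`-form `∂α ∈ Ω¹(Q)`, `∂α = s^* α - t^* α`, evaluated at `(r, l) ∈ Q` on a vector
`(u, w)` tangent to `Q`, i.e. with `d(tgt) u = d(proj) w`. On vectors tangent to `Q` the derivative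
within `Q` of the action does not depend on the choices made in `mfderivWithin`. -/
def boundary (α : DiffForm EL L 1) (r : R) (l : L)
    (u : TangentSpace 𝓘(ℝ, ER) r) (w : TangentSpace 𝓘(ℝ, EL) l) : ℝ :=
  α.eval (𝓛.act r l)
    (mfderivWithin (𝓘(ℝ, ER).prod 𝓘(ℝ, EL)) 𝓘(ℝ, EL) (fun q : R × L => 𝓛.act q.1 q.2)
      𝓛.actionArrows (r, l) (u, w))
  - α.eval l w

/-- `θ + η ∈ Ω¹(R) ⊕ Ω²(M)` is the pseudo-curvature of the pseudo-connection `α ∈ Ω¹(L)`: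
`α` is a connection form on `L → M`, and the total differential `δα = ∂α + dα` is the pull-back of
`θ + η` along the groupoid homomorphism from `Q ⇉ L` to `R ⇉ M`. -/
structure IsPseudoCurvature (α : DiffForm EL L 1) (θ : DiffForm ER R 1) (η : DiffForm EM M 2) :
    Prop where
  connection : IsConnectionForm α
  boundary_eq : ∀ (r : R) (l : L), (r, l) ∈ 𝓛.actionArrows →
    ∀ (u : TangentSpace 𝓘(ℝ, ER) r) (w : TangentSpace 𝓘(ℝ, EL) l),
      (mfderiv 𝓘(ℝ, ER) 𝓘(ℝ, EM) ℛ.tgt r u : EM) = mfderiv 𝓘(ℝ, EL) 𝓘(ℝ, EM) 𝓛.proj l w →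
      𝓛.boundary α r l u w = θ.eval r u
  extD_eq : extD α = pullback 𝓛.proj η

end GroupoidCircleBundle

/-- The cochains `θ + η` and `θ' + η'` in `Ω¹(R) ⊕ Ω²(M)` differ by a coboundary of the total de
Rham complex of `R ⇉ M`: there are `g ∈ Ω⁰(R)` and `β ∈ Ω¹(M)` such that
`(θ + η) - (θ' + η') = δ(g + β)`. As `δ(g + β) = ∂g + (∂β - dg) + dβ` with `∂g ∈ Ω⁰(R₂)`, where `R₂`
is the space of composable pairs, and `∂β = s^* β - t^* β`, this is the following system. -/
def IsCohomologous (ℛ : LieGroupoid EM ER M R) (θ : DiffForm ER R 1) (η : DiffForm EM M 2)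
    (θ' : DiffForm ER R 1) (η' : DiffForm EM M 2) : Prop :=
  ∃ (g : R → ℝ) (β : DiffForm EM M 1), ContMDiff 𝓘(ℝ, ER) 𝓘(ℝ, ℝ) ∞ g ∧
    (∀ x y, ℛ.tgt x = ℛ.src y → g y - g (ℛ.mul x y) + g x = 0) ∧
    (∀ (x : R) (u : TangentSpace 𝓘(ℝ, ER) x),
      θ.eval x u - θ'.eval x u =
        β.eval (ℛ.src x) (mfderiv 𝓘(ℝ, ER) 𝓘(ℝ, EM) ℛ.src x u)
        - β.eval (ℛ.tgt x) (mfderiv 𝓘(ℝ, ER) 𝓘(ℝ, EM) ℛ.tgt x u)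
        - mvfderiv 𝓘(ℝ, ER) g x u) ∧
    (∀ x : M, η.toFun x - η'.toFun x = extD β x)

namespace GroupoidCircleBundle

variable {ℛ : LieGroupoid EM ER M R} (𝓛 : GroupoidCircleBundle EL L ℛ)

/-- `θ + η` represents the Chern class of `L`, the class in the de Rham cohomology of `R ⇉ M` of the
pseudo-curvature of a pseudo-connection. (In particular `θ + η` is a cocycle.) -/
def RepresentsChernClass (θ : DiffForm ER R 1) (η : DiffForm EM M 2) : Prop :=
  ∃ (α : DiffForm EL L 1) (θ' : DiffForm ER R 1) (η' : DiffForm EM M 2),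
    𝓛.IsPseudoCurvature α θ' η' ∧ IsCohomologous ℛ θ η θ' η'

/-- The pull-back `f_m^* L`, a circle bundle over the groupoid `S¹ ⇉ ·` with total space the fibre
of `L` over `m`, is isomorphic to `B_k`, the bundle `S¹ → ·` on which `λ` acts as `z ↦ λ^k z`. -/
def PullbackIsoStandard [MulAction Circle R] (m : M) (k : ℤ) : Prop :=
  ∃ φ : Circle → L, ContMDiff (𝓡 1) 𝓘(ℝ, EL) ∞ φ ∧
    Set.BijOn φ Set.univ (𝓛.proj ⁻¹' {m}) ∧
    (∀ z w : Circle, φ (z * w) = z • φ w) ∧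
    (∀ z w : Circle, φ (z ^ k * w) = 𝓛.act (ℛ.centralMap m z) (φ w))

/-- The index `Ind_m(L)`: the integer that is the class of `f_m^* L` in the group `ℤ` of isomorphism
classes of circle bundles over `S¹ ⇉ ·`, in which `B_k` has the class `k`. -/
def index [MulAction Circle R] (m : M) : ℤ :=
  Classical.epsilon (fun k : ℤ => 𝓛.PullbackIsoStandard m k)

end GroupoidCircleBundle

/-! ### The associated line bundle -/

variable (L) in
/-- The pairs `(l, c)` and `(l · z, z⁻¹ c)` define the same point of `L ×_{S¹} ℂ`. -/
def lineSetoid : Setoid (L × ℂ) where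
  r a b := ∃ z : Circle, b.1 = z • a.1 ∧ b.2 = ((z⁻¹ : Circle) : ℂ) * a.2
  iseqv :=
    { refl := fun a => ⟨1, by simp⟩
      symm := by
        rintro ⟨l, c⟩ ⟨l', c'⟩ ⟨z, h1, h2⟩
        simp only at h1 h2
        subst h1 h2
        exact ⟨z⁻¹, by simp, by simp⟩
      trans := by
        rintro ⟨l, c⟩ ⟨l', c'⟩ ⟨l'', c''⟩ ⟨z, h1, h2⟩ ⟨w, h3, h4⟩
        simp only at h1 h2 h3 h4
        subst h1 h2 h3 h4
        exact ⟨w * z, by simp [mul_smul], by simp; ring⟩ }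

variable (L) in
/-- The complex line bundle `L ×_{S¹} ℂ` associated with a principal circle bundle `L`. -/
def AssociatedLine : Type _ := Quotient (lineSetoid L)

/-- The point `[l, c]` of the associated line bundle. -/
def AssociatedLine.mk (l : L) (c : ℂ) : AssociatedLine L := Quotient.mk (lineSetoid L) (l, c)

/-- Scalar multiplication `a [l, c] = [l, a c]` in the fibres of the associated line bundle. -/
def AssociatedLine.scale (a : ℂ) : AssociatedLine L → AssociatedLine L :=
  Quotient.map' (s₁ := lineSetoid L) (s₂ := lineSetoid L) (fun q => (q.1, a * q.2)) (by
    rintro ⟨l, c⟩ ⟨l', c'⟩ ⟨z, h1, h2⟩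
    exact ⟨z, h1, by simp only at h2 ⊢; rw [h2]; ring⟩)

namespace GroupoidCircleBundle

variable {ℛ : LieGroupoid EM ER M R} (𝓛 : GroupoidCircleBundle EL L ℛ)

/-- The action `r · [l, c] = [r · l, c]` of `R` on the associated line bundle is well defined. -/
theorem mk_act_congr {r : R} {l l' : L} {c c' : ℂ} (hr : ℛ.tgt r = 𝓛.proj l)
    (h : AssociatedLine.mk l c = AssociatedLine.mk l' c') :
    AssociatedLine.mk (𝓛.act r l) c = AssociatedLine.mk (𝓛.act r l') c' := by
  obtain ⟨z, h1, h2⟩ := Quotient.exact h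
  simp only at h1 h2
  subst h1 h2
  rw [𝓛.act_smul r l z hr]
  exact Quotient.sound ⟨z, rfl, rfl⟩

/-- `L` defines a twisted line bundle: the subgroupoid `ker π ≅ M × S¹` of the arrows `λ • 1_m` acts
on the associated line bundle, by `r · [l, c] = [r · l, c]`, through scalar multiplication. -/
def IsTwisted [MulAction Circle R] : Prop :=
  ∀ (m : M) (z : Circle) (l : L) (c : ℂ), 𝓛.proj l = m →
    AssociatedLine.mk (𝓛.act (ℛ.centralMap m z) l) c
      = AssociatedLine.scale (z : ℂ) (AssociatedLine.mk l c)

end GroupoidCircleBundle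

/-- The fibre `π⁻¹(ε(m))` of a central extension over a unit is the circle orbit of `1_m`. -/
theorem IsCentralExtension.range_centralMap [MulAction Circle R] {ℛ : LieGroupoid EM ER M R}
    {𝒢 : LieGroupoid EM EG M G} {π : R → G} (h : IsCentralExtension ℛ 𝒢 π) (m : M) :
    Set.range (ℛ.centralMap m) = π ⁻¹' {𝒢.unit m} := by
  ext x
  constructor
  · rintro ⟨z, rfl⟩
    simp [LieGroupoid.centralMap, h.principal.proj_smul, h.map_unit]
  · intro hx
    obtain ⟨U, e, -, hb, hs, -, -, -, h1, h2⟩ := h.principal.locally_trivial (𝒢.unit m)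
    have hx' : π x = 𝒢.unit m := hx
    have hxs : x ∈ e.source := by rw [hs]; simpa [hx'] using hb
    have hu : ℛ.unit m ∈ e.source := by rw [hs]; simpa [h.map_unit] using hb
    have hz : ∀ z : Circle, z • ℛ.unit m ∈ e.source := by
      intro z
      rw [hs]
      simpa [h.principal.proj_smul, h.map_unit] using hb
    refine ⟨(e x).2 * (e (ℛ.unit m)).2⁻¹, e.injOn (hz _) hxs ?_⟩
    rw [h2 _ hu]
    ext1
    · rw [h1 _ hu, h1 _ hxs, hx', h.map_unit]
    · simp

/-- The integral of `θ` over the circle `π⁻¹(ε(m)) = S¹ • 1_m`, oriented by the circle action. -/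
def unitFibreIntegral [MulAction Circle R] (ℛ : LieGroupoid EM ER M R) (θ : DiffForm ER R 1) (m : M) : ℝ :=
  orbitIntegral θ (ℛ.unit m)

end Extensions

end CircleExtension

end

/-! Central arrows commute with the principal action, so the circle over `m` acts on the fibre of
`L` over `m` through a continuous character of the circle. Such a character is a power map, because
it lifts to a linear map of ℝ (`exists_forall_eq_zpow`); its exponent is the index
(`act_centralMap`).

The index is constant along arrows of `R`, because the extension is central
(`index_src_eq_index_tgt`). It is locally constant on `M`, because a nontrivial power map does not
stay near 1 (`isLocallyConstant_index`). Hence it descends to a locally constant function on the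
connected orbit space.

For the integral, let `r` run along the loop of central arrows at `m` and fix `l` over `m`. The
target `l` stays fixed while the source `r · l` runs along the orbit of `l` at `Ind_m(L)` times unit
speed, so `∂α` takes the value `Ind_m(L)` on the velocity of the loop. A change of representative
adds terms in `β`, which vanish as source and target are constant on the loop, and an exact term
`dg`, which integrates to zero. -/

namespace CircleExtension

/-! ### Characters of the circle -/

/-- A continuous endomorphism of the circle group is a power map. -/
theorem exists_forall_eq_zpow (χ : Circle →* Circle) (hχ : Continuous χ) :
    ∃ k : ℤ, ∀ z, χ z = z ^ k := by
  obtain ⟨F, ⟨hF0, hF⟩, -⟩ := Circle.isCoveringMap_exp.existsUnique_continuousMap_lifts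
    (⟨fun t : ℝ => χ (Circle.exp t), by fun_prop⟩ : C(ℝ, Circle)) (a₀ := 0) (e₀ := 0) (by simp)
  have hF' : ∀ t, Circle.exp (F t) = χ (Circle.exp t) := fun t => congrFun hF t
  -- For fixed `s` both sides lift `t ↦ χ (exp (s + t))` and agree at `t = 0`, so uniqueness of
  -- lifts applies.
  have hadd : ∀ s t, F (s + t) = F s + F t := by
    intro s t
    have h := Circle.isCoveringMap_exp.eq_of_comp_eq (g₁ := fun t => F (s + t))
      (g₂ := fun t => F s + F t) (by fun_prop) (by fun_prop)
      (by funext t; simp [hF', Circle.exp_add]) 0 (by simp [hF0])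
    exact congrFun h t
  let f : ℝ →+ ℝ := ⟨⟨F, hF0⟩, hadd⟩
  have hlin : ∀ t, F t = t * F 1 := fun t => by
    have h : f (t • 1) = t • f 1 := map_real_smul f F.continuous t 1
    rwa [smul_eq_mul, mul_one] at h
  -- `F` is linear and sends the period `2π` into `2πℤ`, so its slope is an integer.
  have h1 : Circle.exp (F (2 * Real.pi)) = 1 := by simp [hF']
  obtain ⟨k, hk⟩ := Circle.exp_eq_one.1 h1
  have hF1 : F 1 = k := by
    rw [hlin] at hk
    have := Real.pi_pos
    have h2 : (2 * Real.pi) * F 1 = (2 * Real.pi) * k := by linarith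
    exact mul_left_cancel₀ (by positivity) h2
  refine ⟨k, fun z => ?_⟩
  obtain ⟨t, rfl⟩ := Circle.exp_surjective z
  rw [← hF', hlin, hF1, mul_comm, ← zsmul_eq_mul, Circle.exp_zsmul]

/-- If `j ≠ 0`, then `z = exp (π / j)` has `z ^ j = -1`, at distance 2 from 1. This gives both the
uniqueness of exponents and, as an open condition, their local constancy. -/
theorem eq_zero_of_forall_norm_zpow_sub_one_lt {j : ℤ}
    (h : ∀ z : Circle, ‖((z ^ j : Circle) : ℂ) - 1‖ < 1) : j = 0 := by
  by_contra hj
  have h1 := h (Circle.exp (Real.pi / j))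
  rw [← Circle.exp_zsmul, zsmul_eq_mul, mul_div_cancel₀ _ (by exact_mod_cast hj)] at h1
  norm_num [Circle.coe_exp] at h1

theorem orbitCurve_add {P : Type*} [MulAction Circle P] (x : P) (s t : ℝ) :
    orbitCurve x (s + t) = orbitCurve (orbitCurve x s) t := by
  simp only [orbitCurve]
  rw [smul_smul, ← Circle.exp_add]
  ring_nf

/-! ### Principal circle bundles and their associated lines -/

section Bundles

variable {E F : Type*} [NormedAddCommGroup E] [NormedSpace ℝ E]
  [NormedAddCommGroup F] [NormedSpace ℝ F]
  {P B : Type*} [TopologicalSpace P] [ChartedSpace E P]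
  [TopologicalSpace B] [ChartedSpace F B] [MulAction Circle P] {p : P → B}

namespace IsPrincipalCircleBundle

/-- Near each base point there are a continuous section and an equivariant fibre coordinate. -/
theorem exists_section_coordinate (h : IsPrincipalCircleBundle E F p) (b : B) :
    ∃ (U : Set B) (s : B → P) (a : P → Circle), IsOpen U ∧ b ∈ U ∧
      ContinuousOn s U ∧ ContinuousOn a (p ⁻¹' U) ∧ (∀ y ∈ U, p (s y) = y) ∧
      (∀ x z, p x ∈ U → a (z • x) = z * a x) ∧ (∀ y ∈ U, a (s y) = 1) ∧
      ∀ x y, p x ∈ U → p x = p y → a x = a y → x = y := by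
  obtain ⟨U, e, hU, hb, hs, ht, -, -, h1, h2⟩ := h.locally_trivial b
  have htar : ∀ y ∈ U, (y, (1 : Circle)) ∈ e.target := fun y hy => by simp [ht, hy]
  have hmem : ∀ x, p x ∈ U → x ∈ e.source := fun x hx => by rw [hs]; exact hx
  refine ⟨U, fun y => e.symm (y, 1), fun x => (e x).2, hU, hb, ?_, ?_, ?_, ?_, ?_, ?_⟩
  · exact e.continuousOn_symm.comp (by fun_prop) htar
  · rw [← hs]
    exact continuous_snd.comp_continuousOn e.continuousOn
  · intro y hy
    rw [← h1 _ (e.map_target (htar y hy)), e.right_inv (htar y hy)]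
  · intro x z hx
    simp [h2 x (hmem x hx) z]
  · intro y hy
    simp [e.right_inv (htar y hy)]
  · intro x y hx hxy ha
    refine e.injOn (hmem x hx) (hmem y (hxy ▸ hx)) (Prod.ext ?_ ha)
    rw [h1 _ (hmem x hx), h1 _ (hmem y (hxy ▸ hx)), hxy]

theorem surjective (h : IsPrincipalCircleBundle E F p) : Function.Surjective p := fun b => by
  obtain ⟨U, s, a, -, hb, -, -, hs, -⟩ := h.exists_section_coordinate b
  exact ⟨s b, hs b hb⟩

theorem smul_left_injective (h : IsPrincipalCircleBundle E F p) (x : P) :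
    Function.Injective (fun z : Circle => z • x) := fun z w hzw => by
  obtain ⟨U, s, a, -, hb, -, -, -, ha, -⟩ := h.exists_section_coordinate (p x)
  have := congrArg a hzw
  simpa [ha x _ hb] using this

theorem exists_smul_eq (h : IsPrincipalCircleBundle E F p) {x y : P} (hxy : p x = p y) :
    ∃ z : Circle, z • x = y := by
  obtain ⟨U, s, a, -, hb, -, -, -, ha, -, hinj⟩ := h.exists_section_coordinate (p x)
  refine ⟨a y * (a x)⁻¹, hinj _ _ (by rwa [h.proj_smul]) (by rw [h.proj_smul, hxy]) ?_⟩
  simp [ha x _ hb]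

theorem contMDiff_smul_const (h : IsPrincipalCircleBundle E F p) (x : P) :
    ContMDiff (𝓡 1) 𝓘(ℝ, E) ∞ (fun z : Circle => z • x) :=
  h.contMDiff_smul.comp (contMDiff_id.prodMk contMDiff_const)

theorem contMDiff_orbitCurve (h : IsPrincipalCircleBundle E F p) (x : P) :
    ContMDiff 𝓘(ℝ, ℝ) 𝓘(ℝ, E) ∞ (orbitCurve x) := by
  refine (h.contMDiff_smul_const x).comp (contMDiff_circleExp.comp ?_)
  exact (contDiff_const.mul contDiff_id).contMDiff

end IsPrincipalCircleBundle

end Bundles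

theorem AssociatedLine.mk_smul_eq_scale {L : Type*} [MulAction Circle L] (w : Circle) (l : L) (c : ℂ) :
    AssociatedLine.mk (w • l) c = AssociatedLine.scale (w : ℂ) (AssociatedLine.mk l c) :=
  (Quotient.sound (s := lineSetoid L) ⟨w, rfl, by simp⟩ :
    Quotient.mk (lineSetoid L) (l, (w : ℂ) * c) = Quotient.mk (lineSetoid L) (w • l, c)).symm

section Bundles

variable {E F : Type*} [NormedAddCommGroup E] [NormedSpace ℝ E]
  [NormedAddCommGroup F] [NormedSpace ℝ F]
  {P B : Type*} [TopologicalSpace P] [ChartedSpace E P]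
  [TopologicalSpace B] [ChartedSpace F B] [MulAction Circle P] {p : P → B}

/-- The action is free, so the circle element relating two representatives with the same `l` is 1.
-/
theorem IsPrincipalCircleBundle.scale_mk_injective
    (h : IsPrincipalCircleBundle E F p) {a b : ℂ} {l : P}
    (hab : AssociatedLine.scale a (AssociatedLine.mk l 1) =
      AssociatedLine.scale b (AssociatedLine.mk l 1)) : a = b := by
  obtain ⟨z, h1, h2⟩ := Quotient.exact (s := lineSetoid P) (a := (l, a * 1)) (b := (l, b * 1)) hab
  have hz : (1 : Circle) = z := h.smul_left_injective l (by simpa using h1)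
  subst hz
  simpa using h2.symm

end Bundles

/-! ### The index: existence, uniqueness and constancy -/

section Extensions

variable {EM EG ER EL : Type*} [NormedAddCommGroup EM] [NormedSpace ℝ EM]
  [NormedAddCommGroup EG] [NormedSpace ℝ EG] [NormedAddCommGroup ER] [NormedSpace ℝ ER]
  [NormedAddCommGroup EL] [NormedSpace ℝ EL]
  {M G R L : Type*} [TopologicalSpace M] [ChartedSpace EM M]
  [TopologicalSpace G] [ChartedSpace EG G] [TopologicalSpace R] [ChartedSpace ER R]
  [TopologicalSpace L] [ChartedSpace EL L] [MulAction Circle R] [MulAction Circle L]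
  {ℛ : LieGroupoid EM ER M R} {𝒢 : LieGroupoid EM EG M G} {π : R → G}

namespace IsCentralExtension

theorem src_smul (hπ : IsCentralExtension ℛ 𝒢 π) (z : Circle) (x : R) :
    ℛ.src (z • x) = ℛ.src x := by
  rw [← hπ.src_map, ← hπ.src_map, hπ.principal.proj_smul]

theorem tgt_smul (hπ : IsCentralExtension ℛ 𝒢 π) (z : Circle) (x : R) :
    ℛ.tgt (z • x) = ℛ.tgt x := by
  rw [← hπ.tgt_map, ← hπ.tgt_map, hπ.principal.proj_smul]

theorem src_centralMap (hπ : IsCentralExtension ℛ 𝒢 π) (m : M) (z : Circle) :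
    ℛ.src (ℛ.centralMap m z) = m := by
  rw [LieGroupoid.centralMap, hπ.src_smul, ℛ.src_unit]

theorem tgt_centralMap (hπ : IsCentralExtension ℛ 𝒢 π) (m : M) (z : Circle) :
    ℛ.tgt (ℛ.centralMap m z) = m := by
  rw [LieGroupoid.centralMap, hπ.tgt_smul, ℛ.tgt_unit]

theorem centralMap_mul (hπ : IsCentralExtension ℛ 𝒢 π) (x : R) (z : Circle) :
    ℛ.mul (ℛ.centralMap (ℛ.src x) z) x = z • x := by
  have h := hπ.smul_mul_smul z 1 (ℛ.unit (ℛ.src x)) x (ℛ.tgt_unit _)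
  rwa [one_smul, mul_one, ℛ.unit_mul] at h

theorem mul_centralMap (hπ : IsCentralExtension ℛ 𝒢 π) (x : R) (z : Circle) :
    ℛ.mul x (ℛ.centralMap (ℛ.tgt x) z) = z • x := by
  have h := hπ.smul_mul_smul 1 z x (ℛ.unit (ℛ.tgt x)) (ℛ.src_unit _).symm
  rwa [one_smul, one_mul, ℛ.mul_unit] at h

theorem centralMap_mul_centralMap (hπ : IsCentralExtension ℛ 𝒢 π) (m : M) (z w : Circle) :
    ℛ.mul (ℛ.centralMap m z) (ℛ.centralMap m w) = ℛ.centralMap m (z * w) := by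
  have h := hπ.centralMap_mul (ℛ.centralMap m w) z
  rw [hπ.src_centralMap] at h
  rw [h, LieGroupoid.centralMap, LieGroupoid.centralMap, smul_smul]

theorem continuous_centralMap (hπ : IsCentralExtension ℛ 𝒢 π) :
    Continuous (fun q : M × Circle => ℛ.centralMap q.1 q.2) :=
  hπ.principal.contMDiff_smul.continuous.comp
    (continuous_snd.prodMk (ℛ.contMDiff_unit.continuous.comp continuous_fst))

end IsCentralExtension

namespace GroupoidCircleBundle

variable (𝓛 : GroupoidCircleBundle EL L ℛ)

theorem proj_act_centralMap (hπ : IsCentralExtension ℛ 𝒢 π) (z : Circle) (l : L) :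
    𝓛.proj (𝓛.act (ℛ.centralMap (𝓛.proj l) z) l) = 𝓛.proj l := by
  rw [𝓛.proj_act _ _ (hπ.tgt_centralMap _ _), hπ.src_centralMap]

/-- If a central arrow acts on one point of a fibre as `w`, then it does on the whole fibre. -/
theorem act_centralMap_eq_of_eq (hπ : IsCentralExtension ℛ 𝒢 π) {z w : Circle} {l l' : L}
    (hl : 𝓛.proj l' = 𝓛.proj l) (h : 𝓛.act (ℛ.centralMap (𝓛.proj l) z) l = w • l) :
    𝓛.act (ℛ.centralMap (𝓛.proj l) z) l' = w • l' := by
  obtain ⟨v, rfl⟩ := 𝓛.principal.exists_smul_eq hl.symm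
  rw [𝓛.act_smul _ _ _ (hπ.tgt_centralMap _ _), h, smul_smul, smul_smul, mul_comm]

/-- The central circle over `m` acts on the fibre of `L` over `m` by a power map. -/
theorem exists_act_centralMap_eq (hπ : IsCentralExtension ℛ 𝒢 π) (m : M) :
    ∃ k : ℤ, ∀ (z : Circle) (l : L), 𝓛.proj l = m →
      𝓛.act (ℛ.centralMap m z) l = z ^ k • l := by
  obtain ⟨l₀, rfl⟩ := 𝓛.principal.surjective m
  have hex : ∀ z : Circle, ∃ w : Circle, w • l₀ = 𝓛.act (ℛ.centralMap (𝓛.proj l₀) z) l₀ :=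
    fun z => 𝓛.principal.exists_smul_eq (𝓛.proj_act_centralMap hπ z l₀).symm
  choose χ hχ using hex
  have hinj := 𝓛.principal.smul_left_injective l₀
  have hmul : ∀ z w, χ (z * w) = χ z * χ w := fun z w => hinj <| by
    dsimp only
    rw [hχ, ← hπ.centralMap_mul_centralMap, 𝓛.mul_act _ _ _
      (by rw [hπ.tgt_centralMap, hπ.src_centralMap]) (hπ.tgt_centralMap _ _), ← hχ w,
      𝓛.act_smul _ _ _ (hπ.tgt_centralMap _ _), ← hχ z, smul_smul, mul_comm]
  -- In the fibre coordinate `a`, the point `χ z • l₀` reads `χ z * a l₀`; thus `χ` is obtained from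
  -- the continuous action by applying `a` and dividing by a constant.
  have hcont : Continuous χ := by
    obtain ⟨U, s, a, -, hb, -, hac, -, ha, -⟩ :=
      𝓛.principal.exists_section_coordinate (𝓛.proj l₀)
    have h1 : Continuous fun z => 𝓛.act (ℛ.centralMap (𝓛.proj l₀) z) l₀ :=
      𝓛.contMDiff_act.continuousOn.comp_continuous
        ((hπ.continuous_centralMap.comp (continuous_const.prodMk continuous_id)).prodMk
          continuous_const) fun z => hπ.tgt_centralMap _ _
    have h2 : Continuous fun z => a (𝓛.act (ℛ.centralMap (𝓛.proj l₀) z) l₀) :=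
      hac.comp_continuous h1 fun z => by
        rw [Set.mem_preimage, 𝓛.proj_act_centralMap hπ]; exact hb
    have h3 : χ = fun z => a (𝓛.act (ℛ.centralMap (𝓛.proj l₀) z) l₀) * (a l₀)⁻¹ := by
      funext z
      rw [← hχ, ha l₀ _ hb, mul_inv_cancel_right]
    rw [h3]
    exact h2.mul continuous_const
  obtain ⟨k, hk⟩ := exists_forall_eq_zpow (MonoidHom.mk' χ hmul) hcont
  refine ⟨k, fun z l hl => 𝓛.act_centralMap_eq_of_eq hπ hl ?_⟩
  rw [← hk, ← hχ]
  rfl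

/-- An isomorphism from `B_j` makes the central arrow act on `φ 1` both as `z ^ j` and as `z ^ k`,
and freeness equates the two. Conversely any orbit map `z ↦ z • l₀` is an isomorphism from `B_k`. -/
theorem pullbackIsoStandard_iff {m : M} {k j : ℤ}
    (hk : ∀ (z : Circle) (l : L), 𝓛.proj l = m → 𝓛.act (ℛ.centralMap m z) l = z ^ k • l) :
    𝓛.PullbackIsoStandard m j ↔ j = k := by
  constructor
  · rintro ⟨φ, -, hb, h1, h2⟩
    have hm : 𝓛.proj (φ 1) = m := hb.mapsTo (Set.mem_univ 1)
    have hz : ∀ z : Circle, z ^ j = z ^ k := fun z =>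
      𝓛.principal.smul_left_injective (φ 1) <| by
        dsimp only
        rw [← hk z _ hm, ← h2, h1]
    refine sub_eq_zero.1 (eq_zero_of_forall_norm_zpow_sub_one_lt fun z => ?_)
    rw [zpow_sub, hz, mul_inv_cancel]
    simp
  · rintro rfl
    obtain ⟨l₀, hl₀⟩ := 𝓛.principal.surjective m
    have hm : ∀ z : Circle, 𝓛.proj (z • l₀) = m := fun z => by rw [𝓛.principal.proj_smul, hl₀]
    refine ⟨fun z => z • l₀, 𝓛.principal.contMDiff_smul_const l₀, ⟨fun z _ => hm z,
      (𝓛.principal.smul_left_injective l₀).injOn, fun l hl => ?_⟩, fun z w => mul_smul z w l₀,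
      fun z w => ?_⟩
    · obtain ⟨z, hz⟩ := 𝓛.principal.exists_smul_eq (hl₀.trans (Eq.symm hl))
      exact ⟨z, Set.mem_univ z, hz⟩
    · rw [hk _ _ (hm w)]
      exact mul_smul _ _ _

theorem act_centralMap (hπ : IsCentralExtension ℛ 𝒢 π) (m : M) (z : Circle) (l : L)
    (hl : 𝓛.proj l = m) : 𝓛.act (ℛ.centralMap m z) l = z ^ 𝓛.index m • l := by
  obtain ⟨k, hk⟩ := 𝓛.exists_act_centralMap_eq hπ m
  -- `index` is a choice by `epsilon`: the exponent `k` shows that a valid choice exists, and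
  -- uniqueness identifies the chosen integer with `k`.
  have h : 𝓛.PullbackIsoStandard m (𝓛.index m) :=
    Classical.epsilon_spec (p := fun k => 𝓛.PullbackIsoStandard m k)
      ⟨k, (𝓛.pullbackIsoStandard_iff hk).2 rfl⟩
  rw [(𝓛.pullbackIsoStandard_iff hk).1 h, hk z l hl]

/-- Both `(z • 1) x` and `x (z • 1)` equal `z • x`, with the units at the source and the target of
`x`. Applied to `l`, they multiply `x · l` by the powers of `z` belonging to the two ends. -/
theorem index_src_eq_index_tgt (hπ : IsCentralExtension ℛ 𝒢 π) (x : R) :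
    𝓛.index (ℛ.src x) = 𝓛.index (ℛ.tgt x) := by
  obtain ⟨l, hl⟩ := 𝓛.principal.surjective (ℛ.tgt x)
  have hz : ∀ z : Circle, z ^ 𝓛.index (ℛ.src x) = z ^ 𝓛.index (ℛ.tgt x) := fun z =>
    𝓛.principal.smul_left_injective (𝓛.act x l) <| by
      dsimp only
      rw [← 𝓛.act_centralMap hπ (ℛ.src x) z _ (𝓛.proj_act x l hl.symm),
        ← 𝓛.mul_act _ _ _ (hπ.tgt_centralMap _ _) hl.symm, hπ.centralMap_mul,
        ← hπ.mul_centralMap, 𝓛.mul_act _ _ _ (hπ.src_centralMap _ _).symm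
          ((hπ.tgt_centralMap _ _).trans hl.symm), 𝓛.act_centralMap hπ _ z l hl,
        𝓛.act_smul _ _ _ hl.symm]
  refine sub_eq_zero.1 (eq_zero_of_forall_norm_zpow_sub_one_lt fun z => ?_)
  rw [zpow_sub, hz, mul_inv_cancel]
  simp

/-- A local section and a fibre coordinate exhibit `(m, z) ↦ z ^ index m` as jointly continuous.
Compactness of the circle then keeps `z ^ (index m - index m₀)` within distance 1 of 1 for all `z`
at once when `m` is near `m₀`, which forces the exponent to vanish. -/
theorem isLocallyConstant_index (hπ : IsCentralExtension ℛ 𝒢 π) :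
    IsLocallyConstant 𝓛.index := by
  rw [IsLocallyConstant.iff_eventually_eq]
  intro m₀
  obtain ⟨U, s, a, hU, hb, hsc, hac, hs, ha, has, -⟩ :=
    𝓛.principal.exists_section_coordinate m₀
  have hcoord : ∀ m ∈ U, ∀ z, a (𝓛.act (ℛ.centralMap m z) (s m)) = z ^ 𝓛.index m :=
    fun m hm z => by
      rw [𝓛.act_centralMap hπ m z _ (hs m hm), ha _ _ ((hs m hm).symm ▸ hm), has m hm, mul_one]
  have h1 : ContinuousOn (fun q : M × Circle => 𝓛.act (ℛ.centralMap q.1 q.2) (s q.1))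
      (U ×ˢ Set.univ) :=
    𝓛.contMDiff_act.continuousOn.comp (hπ.continuous_centralMap.continuousOn.prodMk
      (hsc.comp continuousOn_fst fun q hq => hq.1)) fun q hq =>
        (hπ.tgt_centralMap _ _).trans (hs _ hq.1).symm
  have h2 : ContinuousOn (fun q : M × Circle => a (𝓛.act (ℛ.centralMap q.1 q.2) (s q.1)))
      (U ×ˢ Set.univ) :=
    hac.comp h1 fun q hq => by
      have hq' := hs _ hq.1
      rw [Set.mem_preimage, 𝓛.proj_act _ _ ((hπ.tgt_centralMap _ _).trans hq'.symm),
        hπ.src_centralMap]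
      exact hq.1
  have h3 : ContinuousOn (fun q : M × Circle => q.2 ^ 𝓛.index q.1) (U ×ˢ Set.univ) :=
    h2.congr fun q hq => (hcoord _ hq.1 _).symm
  have h4 : ContinuousOn (fun q : M × Circle =>
      ‖((q.2 ^ (𝓛.index q.1 - 𝓛.index m₀) : Circle) : ℂ) - 1‖) (U ×ˢ Set.univ) := by
    have h5 : ContinuousOn (fun q : M × Circle => q.2 ^ 𝓛.index q.1 * (q.2 ^ 𝓛.index m₀)⁻¹)
        (U ×ˢ Set.univ) := h3.mul (by fun_prop)
    simp only [zpow_sub]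
    exact ((continuous_subtype_val.comp_continuousOn h5).sub continuousOn_const).norm
  -- Tube lemma: the norm is 0 at every `(m₀, z)`, so it is less than 1 on a neighbourhood of `m₀`
  -- times the whole circle.
  have h6 := isCompact_univ.eventually_forall_of_forall_eventually (x₀ := m₀)
    (K := (Set.univ : Set Circle))
    (P := fun m z => ‖((z ^ (𝓛.index m - 𝓛.index m₀) : Circle) : ℂ) - 1‖ < 1) fun z _ => by
      have h7 := h4.continuousAt (x := (m₀, z)) ((hU.prod isOpen_univ).mem_nhds ⟨hb, Set.mem_univ z⟩)
      exact h7.eventually (gt_mem_nhds (by simp))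
  filter_upwards [h6] with m hm
  exact sub_eq_zero.1 (eq_zero_of_forall_norm_zpow_sub_one_lt fun z => hm z (Set.mem_univ z))

/-- Arrows of `G` lift to `R` because `π` is surjective, so invariance along `R` makes the index a
continuous integer-valued function on the orbit space. -/
theorem index_eq_index (hπ : IsCentralExtension ℛ 𝒢 π) [PathConnectedSpace 𝒢.OrbitSpace]
    (m n : M) : 𝓛.index m = 𝓛.index n := by
  have hinv : ∀ m n, 𝒢.orbitSetoid m n → 𝓛.index m = 𝓛.index n := by
    rintro m n ⟨g, rfl, rfl⟩
    obtain ⟨x, rfl⟩ := hπ.principal.surjective g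
    rw [hπ.src_map, hπ.tgt_map, 𝓛.index_src_eq_index_tgt hπ]
  have hc : Continuous (Quotient.lift 𝓛.index hinv : 𝒢.OrbitSpace → ℤ) :=
    (𝓛.isLocallyConstant_index hπ).continuous.quotient_lift hinv
  exact PreconnectedSpace.constant inferInstance hc (x := Quotient.mk _ m) (y := Quotient.mk _ n)

theorem isTwisted_iff (hπ : IsCentralExtension ℛ 𝒢 π) :
    𝓛.IsTwisted ↔ ∀ m, 𝓛.index m = 1 := by
  constructor
  · intro h m
    obtain ⟨l, rfl⟩ := 𝓛.principal.surjective m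
    have hz : ∀ z : Circle, z ^ 𝓛.index (𝓛.proj l) = z := fun z => by
      have h1 := h _ z l 1 rfl
      rw [𝓛.act_centralMap hπ _ z l rfl, AssociatedLine.mk_smul_eq_scale] at h1
      exact Circle.ext (𝓛.principal.scale_mk_injective h1)
    refine sub_eq_zero.1 (eq_zero_of_forall_norm_zpow_sub_one_lt fun z => ?_)
    rw [zpow_sub, hz, zpow_one, mul_inv_cancel]
    simp
  · intro h m z l c hl
    rw [𝓛.act_centralMap hπ m z l hl, h, zpow_one, AssociatedLine.mk_smul_eq_scale]

end GroupoidCircleBundle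

end Extensions

/-! ### One-forms evaluated on velocities of curves -/

section Forms

variable {E F : Type*} [NormedAddCommGroup E] [NormedSpace ℝ E]
  [NormedAddCommGroup F] [NormedSpace ℝ F]
  {N P : Type*} [TopologicalSpace N] [ChartedSpace E N]
  [TopologicalSpace P] [ChartedSpace F P]

theorem DiffForm.eval_smul (θ : DiffForm E N 1) (x : N) (a : ℝ) (u : TangentSpace 𝓘(ℝ, E) x) :
    θ.eval x (a • u) = a * θ.eval x u := by
  refine ((θ.toFun x).map_smul_univ (fun _ => a) (fun _ => u)).trans ?_
  rw [Fin.prod_univ_one]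
  rfl

theorem DiffForm.eval_zero (θ : DiffForm E N 1) (x : N) : θ.eval x 0 = 0 := by
  simpa using θ.eval_smul x 0 0

theorem mfderiv_velocity {f : N → P} {c : ℝ → N} {t : ℝ}
    (hf : MDifferentiableAt 𝓘(ℝ, E) 𝓘(ℝ, F) f (c t))
    (hc : MDifferentiableAt 𝓘(ℝ, ℝ) 𝓘(ℝ, E) c t) :
    mfderiv 𝓘(ℝ, E) 𝓘(ℝ, F) f (c t) (velocity E c t) = velocity F (fun s => f (c s)) t := by
  have h := mfderiv_comp t hf hc
  exact (congrArg (fun D : ℝ →L[ℝ] F => D (1 : ℝ)) h).symm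

theorem velocity_const (x : N) (t : ℝ) : velocity E (fun _ => x) t = 0 := by
  rw [velocity, mfderiv_const]
  rfl

theorem mfderiv_velocity_eq_zero {f : N → P} {c : ℝ → N} {t : ℝ} {y : P}
    (hf : MDifferentiableAt 𝓘(ℝ, E) 𝓘(ℝ, F) f (c t))
    (hc : MDifferentiableAt 𝓘(ℝ, ℝ) 𝓘(ℝ, E) c t) (h : ∀ s, f (c s) = y) :
    (mfderiv 𝓘(ℝ, E) 𝓘(ℝ, F) f (c t) (velocity E c t) : F) = 0 := by
  -- The tangent space containing `velocity F b t` depends on `b`, so the equality of curves is used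
  -- by substituting for a variable curve.
  have key : ∀ b : ℝ → P, b = (fun _ => y) → (velocity F b t : F) = 0 := by
    rintro _ rfl
    exact velocity_const y t
  exact (mfderiv_velocity hf hc).trans (key _ (funext h))

theorem mvfderiv_velocity {g : N → ℝ} {c : ℝ → N} {t : ℝ}
    (hg : MDifferentiableAt 𝓘(ℝ, E) 𝓘(ℝ, ℝ) g (c t))
    (hc : MDifferentiableAt 𝓘(ℝ, ℝ) 𝓘(ℝ, E) c t) :
    mvfderiv 𝓘(ℝ, E) g (c t) (velocity E c t) = deriv (fun s => g (c s)) t := by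
  have h : velocity ℝ (fun s => g (c s)) t = deriv (fun s => g (c s)) t := by
    rw [velocity, mfderiv_eq_fderiv]
    rfl
  exact (mfderiv_velocity hg hc).trans h

/-- Needed for `a = 1`, to shift the parameter of an orbit, and for `a` the index with `b = 0`, to
run along an orbit at that speed. -/
theorem velocity_comp_mul_add {c : ℝ → N} {a b t : ℝ}
    (hc : MDifferentiableAt 𝓘(ℝ, ℝ) 𝓘(ℝ, E) c (a * t + b)) :
    velocity E (fun s => c (a * s + b)) t = a • velocity E c (a * t + b) := by
  have h1 : HasDerivAt (fun s => a * s + b) a t := by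
    simpa using ((hasDerivAt_id t).const_mul a).add_const b
  have h2 := hc.hasMFDerivAt.comp t h1.hasFDerivAt.hasMFDerivAt
  have h3 := congrArg (fun D : ℝ →L[ℝ] E => D (1 : ℝ)) h2.mfderiv
  refine Eq.trans h3 ?_
  have h4 : (mfderiv 𝓘(ℝ, ℝ) 𝓘(ℝ, E) c (a * t + b) : ℝ →L[ℝ] E) (a • (1 : ℝ)) =
      a • (mfderiv 𝓘(ℝ, ℝ) 𝓘(ℝ, E) c (a * t + b) : ℝ →L[ℝ] E) (1 : ℝ) := map_smul _ _ _
  refine Eq.trans ?_ h4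
  exact congrArg (mfderiv 𝓘(ℝ, ℝ) 𝓘(ℝ, E) c (a * t + b) : ℝ →L[ℝ] E)
    ((one_mul a).trans (mul_one a).symm)

/-- The normalization holds at parameter 0 of every orbit curve, and the orbit curve of `orbitCurve
x t` is that of `x` with its parameter shifted by `t`. -/
theorem IsConnectionForm.eval_velocity_orbitCurve [MulAction Circle N] {α : DiffForm E N 1}
    (hα : IsConnectionForm α) {x : N} (t : ℝ)
    (hx : MDifferentiable 𝓘(ℝ, ℝ) 𝓘(ℝ, E) (orbitCurve x)) :
    α.eval (orbitCurve x t) (velocity E (orbitCurve x) t) = 1 := by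
  have h := hα.normalized (orbitCurve x t)
  have hc : orbitCurve (orbitCurve x t) = fun s => orbitCurve x (1 * s + t) := by
    funext s
    rw [← orbitCurve_add, one_mul, add_comm]
  have h1 : ∀ c : ℝ → N, c = (fun s => orbitCurve x (1 * s + t)) →
      α.eval (c 0) (velocity E c 0) =
        α.eval (orbitCurve x (1 * 0 + t)) (velocity E (orbitCurve x) (1 * 0 + t)) := by
    rintro _ rfl
    rw [velocity_comp_mul_add (hx _), one_smul]
  have h2 := (h1 _ hc).symm.trans h
  have ht : (1 : ℝ) * 0 + t = t := by ring
  rwa [ht] at h2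

end Forms

/-! ### The integral formula -/

section Extensions

variable {EM EG ER EL : Type*} [NormedAddCommGroup EM] [NormedSpace ℝ EM]
  [NormedAddCommGroup EG] [NormedSpace ℝ EG] [NormedAddCommGroup ER] [NormedSpace ℝ ER]
  [NormedAddCommGroup EL] [NormedSpace ℝ EL]
  {M G R L : Type*} [TopologicalSpace M] [ChartedSpace EM M]
  [TopologicalSpace G] [ChartedSpace EG G] [TopologicalSpace R] [ChartedSpace ER R]
  [TopologicalSpace L] [ChartedSpace EL L] [MulAction Circle L]
  {ℛ : LieGroupoid EM ER M R} {𝒢 : LieGroupoid EM EG M G} {π : R → G}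

namespace GroupoidCircleBundle

variable (𝓛 : GroupoidCircleBundle EL L ℛ)

/-- The curve `s ↦ (c s, l)` stays in `actionArrows`, so the chain rule determines `mfderivWithin`
on its velocity. Uniqueness of derivatives is needed only on ℝ. -/
theorem mfderivWithin_act_velocity {c : ℝ → R} {l : L} {t : ℝ}
    (hc : MDifferentiableAt 𝓘(ℝ, ℝ) 𝓘(ℝ, ER) c t) (hl : ∀ s, ℛ.tgt (c s) = 𝓛.proj l) :
    mfderivWithin (𝓘(ℝ, ER).prod 𝓘(ℝ, EL)) 𝓘(ℝ, EL) (fun q : R × L => 𝓛.act q.1 q.2)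
      𝓛.actionArrows (c t, l) (velocity ER c t, (0 : EL)) =
      velocity EL (fun s => 𝓛.act (c s) l) t := by
  have h1 := ((𝓛.contMDiff_act (c t, l) (hl t)).mdifferentiableWithinAt
    (by simp)).hasMFDerivWithinAt
  have h2 := (hc.hasMFDerivAt.prodMk (hasMFDerivAt_const (I := 𝓘(ℝ, ℝ)) (I' := 𝓘(ℝ, EL)) l t))
  have h3 := (HasMFDerivWithinAt.comp (u := 𝓛.actionArrows) (s := Set.univ)
    (f := fun s => (c s, l)) t h1 h2.hasMFDerivWithinAt fun s _ => hl s).hasMFDerivAt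
    Filter.univ_mem
  exact (congrArg (fun D : ℝ →L[ℝ] EL => D (1 : ℝ)) h3.mfderiv).symm

/-- The restriction to the central circles of the degree-one part of a pseudo-curvature. -/
theorem IsPseudoCurvature.eval_velocity_orbitCurve [MulAction Circle R]
    (hπ : IsCentralExtension ℛ 𝒢 π)
    {𝓛 : GroupoidCircleBundle EL L ℛ}
    {α : DiffForm EL L 1} {θ : DiffForm ER R 1} {η : DiffForm EM M 2}
    (h : 𝓛.IsPseudoCurvature α θ η) (m : M) (t : ℝ) :
    θ.eval (orbitCurve (ℛ.unit m) t) (velocity ER (orbitCurve (ℛ.unit m)) t) = 𝓛.index m := by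
  obtain ⟨l, hl⟩ := 𝓛.principal.surjective m
  have hR : MDifferentiable 𝓘(ℝ, ℝ) 𝓘(ℝ, ER) (orbitCurve (ℛ.unit m)) :=
    (hπ.principal.contMDiff_orbitCurve _).mdifferentiable (by simp)
  have hL : MDifferentiable 𝓘(ℝ, ℝ) 𝓘(ℝ, EL) (orbitCurve l) :=
    (𝓛.principal.contMDiff_orbitCurve _).mdifferentiable (by simp)
  have htgt : ∀ s, ℛ.tgt (orbitCurve (ℛ.unit m) s) = 𝓛.proj l := fun s => by
    rw [hl]
    exact hπ.tgt_centralMap m _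
  have hact : (fun s => 𝓛.act (orbitCurve (ℛ.unit m) s) l) =
      fun s => orbitCurve l (𝓛.index m * s + 0) := by
    funext s
    refine (𝓛.act_centralMap hπ m _ l hl).trans ?_
    rw [← Circle.exp_zsmul, orbitCurve, zsmul_eq_mul]
    ring_nf
  -- The vector `(velocity, 0)` is tangent to the fibre product because the target is constant along
  -- the central loop.
  have h1 := h.boundary_eq (orbitCurve (ℛ.unit m) t) l (htgt t)
    (velocity ER (orbitCurve (ℛ.unit m)) t) (0 : EL)
    ((mfderiv_velocity_eq_zero ((ℛ.contMDiff_tgt _).mdifferentiableAt (by simp)) (hR t)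
      htgt).trans (map_zero (mfderiv 𝓘(ℝ, EL) 𝓘(ℝ, EM) 𝓛.proj l)).symm)
  rw [← h1]
  have h2 : α.eval l (0 : EL) = 0 := α.eval_zero l
  have h3 : ∀ c : ℝ → L, c = (fun s => orbitCurve l (𝓛.index m * s + 0)) →
      α.eval (c t) (velocity EL c t) = 𝓛.index m := by
    rintro _ rfl
    rw [velocity_comp_mul_add (hL _), DiffForm.eval_smul,
      h.connection.eval_velocity_orbitCurve _ hL, mul_one]
  have h4 := congrArg (α.eval (𝓛.act (orbitCurve (ℛ.unit m) t) l))
    (𝓛.mfderivWithin_act_velocity (hR t) htgt)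
  exact (congrArg₂ (· - ·) (h4.trans (h3 _ hact)) h2).trans (sub_zero _)

/-- Along the central loop `c` source and target are constant, so the `β` terms vanish and `θ`
evaluates to the index minus `(g ∘ c)'`. The derivative integrates to zero because `c 1 = c 0`. -/
theorem unitFibreIntegral_eq_index [MulAction Circle R]
    (hπ : IsCentralExtension ℛ 𝒢 π)
    {θ : DiffForm ER R 1} {η : DiffForm EM M 2} (h : 𝓛.RepresentsChernClass θ η) (m : M) :
    unitFibreIntegral ℛ θ m = 𝓛.index m := by
  obtain ⟨α, θ', η', hα, g, β, hg, -, hθ, -⟩ := h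
  set c := orbitCurve (ℛ.unit m) with hc
  have hcs : ContMDiff 𝓘(ℝ, ℝ) 𝓘(ℝ, ER) ∞ c := hπ.principal.contMDiff_orbitCurve _
  have hcd : MDifferentiable 𝓘(ℝ, ℝ) 𝓘(ℝ, ER) c := hcs.mdifferentiable (by simp)
  have hgc : ContDiff ℝ ∞ (fun s => g (c s)) := (hg.comp hcs).contDiff
  have heval : ∀ t, θ.eval (c t) (velocity ER c t) =
      𝓛.index m - deriv (fun s => g (c s)) t := by
    intro t
    have h1 := hθ (c t) (velocity ER c t)
    rw [mfderiv_velocity_eq_zero ((ℛ.contMDiff_src _).mdifferentiableAt (by simp)) (hcd t)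
        (fun s => hπ.src_centralMap m _),
      mfderiv_velocity_eq_zero ((ℛ.contMDiff_tgt _).mdifferentiableAt (by simp)) (hcd t)
        (fun s => hπ.tgt_centralMap m _),
      mvfderiv_velocity ((hg _).mdifferentiableAt (by simp)) (hcd t),
      hα.eval_velocity_orbitCurve hπ m t] at h1
    have h2 : ∀ x, β.eval x (0 : EM) = 0 := β.eval_zero
    have h3 := h1.trans (congrArg₂ (fun a b : ℝ => a - b - deriv (fun s => g (c s)) t)
      (h2 (ℛ.src (c t))) (h2 (ℛ.tgt (c t))))
    linarith
  have hcont : Continuous (deriv fun s => g (c s)) := hgc.continuous_deriv (by simp)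
  have hloop : c 1 = c 0 := by simp [hc, orbitCurve]
  rw [unitFibreIntegral, orbitIntegral, intervalIntegral.integral_congr fun t _ => heval t,
    intervalIntegral.integral_sub (by simp) (hcont.intervalIntegrable _ _),
    intervalIntegral.integral_deriv_eq_sub
      (fun t _ => (hgc.differentiable (by simp)).differentiableAt)
      (hcont.intervalIntegrable _ _), hloop]
  simp

end GroupoidCircleBundle

end Extensions

end CircleExtension

theorem mainTheorem11
    {EM EG ER EL : Type*}
    [NormedAddCommGroup EM] [NormedSpace ℝ EM] [FiniteDimensional ℝ EM]
    [NormedAddCommGroup EG] [NormedSpace ℝ EG] [FiniteDimensional ℝ EG]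
    [NormedAddCommGroup ER] [NormedSpace ℝ ER] [FiniteDimensional ℝ ER]
    [NormedAddCommGroup EL] [NormedSpace ℝ EL] [FiniteDimensional ℝ EL]
    {M G R L : Type*}
    [TopologicalSpace M] [ChartedSpace EM M] [IsManifold 𝓘(ℝ, EM) ∞ M]
    [TopologicalSpace G] [ChartedSpace EG G] [IsManifold 𝓘(ℝ, EG) ∞ G]
    [TopologicalSpace R] [ChartedSpace ER R] [IsManifold 𝓘(ℝ, ER) ∞ R]
    [TopologicalSpace L] [ChartedSpace EL L] [IsManifold 𝓘(ℝ, EL) ∞ L]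
    [MulAction Circle R] [MulAction Circle L]
    (𝒢 : CircleExtension.LieGroupoid EM EG M G)
    (ℛ : CircleExtension.LieGroupoid EM ER M R)
    (π : R → G) (_hπ : CircleExtension.IsCentralExtension ℛ 𝒢 π)
    [PathConnectedSpace 𝒢.OrbitSpace]
    (𝓛 : CircleExtension.GroupoidCircleBundle EL L ℛ)
    (θ : CircleExtension.DiffForm ER R 1) (η : CircleExtension.DiffForm EM M 2)
    (_hθη : 𝓛.RepresentsChernClass θ η) :
    -- the index is well defined, and is the integer by which the central circle acts
    (∀ (m : M) (k : ℤ), 𝓛.PullbackIsoStandard m k ↔ k = 𝓛.index m) ∧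
    (∀ (m : M) (z : Circle) (l : L), 𝓛.proj l = m →
      𝓛.act (ℛ.centralMap m z) l = z ^ 𝓛.index m • l) ∧
    (∀ m n : M, 𝓛.index m = 𝓛.index n) ∧
    -- the integral formula for the index
    (∀ m : M, (𝓛.index m : ℝ) = CircleExtension.unitFibreIntegral ℛ θ m) ∧
    -- the criterion for twisted line bundles
    (∀ m : M, 𝓛.IsTwisted ↔ CircleExtension.unitFibreIntegral ℛ θ m = 1) := by
  have hindex := 𝓛.unitFibreIntegral_eq_index _hπ _hθη
  refine ⟨fun m k => 𝓛.pullbackIsoStandard_iff (𝓛.act_centralMap _hπ m),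
    𝓛.act_centralMap _hπ, 𝓛.index_eq_index _hπ, fun m => (hindex m).symm, fun m => ?_⟩
  -- Being twisted requires index 1 at every point, the integral concerns a single `m`; constancy of
  -- the index closes the gap.
  rw [hindex, 𝓛.isTwisted_iff _hπ, Int.cast_eq_one]
  exact ⟨fun h => h m, fun h n => (𝓛.index_eq_index _hπ n m).trans h⟩
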